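/- There are absolute constants $C, c > 0$ such that the following holds. Let $n, d, k \ge 1$ be integers and $\epsilon > 0$. Let $\Sigma_1, \dots, \Sigma_k \in \mathbb{R}^{d \times d}$ be symmetric positive-definite matrices, let $\lambda, \Lambda > 0$ satisfy $\lambda I \preceq \Sigma_j \preceq \Lambda I$ for all $j$ (in the Loewner order), and put $\kappa = \Lambda/\lambda$. Let $w_1, \dots, w_k \ge 0$ with $w_1 + \dots + w_k = 1$, and let $Z_1, \dots, Z_n$ be independent random vectors in $\mathbb{R}^d$, each distributed according to the mixture $\sum_{j=1}^k w_j N(0, \Sigma_j)$. If $n \ge C d \log(n)/\epsilon^2$, then with probability at least $1 - \exp(-c\,\epsilon^2 n)$ the samples $(Z_i)_{i=1}^n$ satisfy $(\epsilon, \epsilon/(4\kappa))$-strong anti-concentration, that is, for every $\beta \in \mathbb{R}^d$, \[\left|\left\{i \in [n] : |\langle Z_i, \beta\rangle| < \frac{\epsilon}{4\kappa\sqrt{n}}\, \|Z\beta\|_2\right\}\right| \le \epsilon n,\] where $Z$ is the $n \times d$ matrix with rows $Z_1, \dots, Z_n$. -/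

import Mathlib

open MeasureTheory ProbabilityTheory

/-- Samples `Z₁, …, Zₙ ∈ ℝᵈ` satisfy `(ε, δ)`-strong anti-concentration if for every `β ∈ ℝᵈ`,
`|{i ∈ [n] : |⟨Zᵢ, β⟩| < (δ / √n) ‖Z β‖₂}| ≤ ε n`, where `Z` is the `n × d` matrix with rows
`Z₁, …, Zₙ`; so `Z β` is the vector `(⟨Zᵢ, β⟩)ᵢ`, measured in the Euclidean norm of `ℝⁿ`. -/
def StrongAntiConcentration {n d : ℕ} (Z : Fin n → EuclideanSpace ℝ (Fin d)) (ε δ : ℝ) : Prop :=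
  ∀ β : EuclideanSpace ℝ (Fin d),
    (Set.ncard {i : Fin n | |inner ℝ (Z i) β| <
      δ / Real.sqrt n * ‖WithLp.toLp 2 (fun l : Fin n => inner ℝ (Z l) β)‖} : ℝ) ≤ ε * n

/-- The mixture `∑ⱼ wⱼ N(0, Σⱼ)` of centered Gaussian distributions on `ℝᵈ`. -/
noncomputable def centeredGaussianMixture {d k : ℕ} (w : Fin k → ℝ)
    (S : Fin k → Matrix (Fin d) (Fin d) ℝ) : Measure (EuclideanSpace ℝ (Fin d)) :=
  ∑ j, ENNReal.ofReal (w j) • multivariateGaussian 0 (S j)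

/-! The proof is a union bound over a finite net. The condition is invariant under scaling `β`, so
`β` may be given norm `m`; rounding its coordinates then leaves only nonzero points `u` of an
integer box. Write `x = κ^(1/4)` and `a = √λ`. For fixed `u`, Chernoff bounds give, outside a small
event, `‖Zu‖ ≤ 2 a x³ √n ‖u‖` (`measure_sum_inner_sq_gt_le`) and at most `εn` samples in the slab
`|⟨Zᵢ, u⟩| ≤ (3/5)(εa/x)‖u‖` (`measure_ncard_abs_inner_le_gt_le`). The threshold at `u` is then at
most `(1/2)(εa/x)‖u‖`, and the slack between 1/2 and 3/5 absorbs the rounding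
(`strongAntiConcentration_of_lattice`). The sample size does not depend on `κ` because of how `κ` is
split: allowing second moments of order `Λ√κ` still leaves a slab of mass at most `ε/(2x)`. Both
failure probabilities gain a factor `exp(-εn log x / 2)`, which pays for the `x^(4d)` in the size of
the net (`card_mul_exp_le`). -/

/-! ### One-dimensional Gaussian estimates and projections of the mixture -/

/-- The exponential moment of `s x²` under a centered Gaussian of variance `v ≤ 1 / (4s)`. -/
theorem lintegral_exp_sq_gaussianReal_le {v : NNReal} (hv : v ≠ 0) {s : ℝ} (hs : s * v ≤ 1 / 4) :
    ∫⁻ x, ENNReal.ofReal (Real.exp (s * x ^ 2)) ∂(gaussianReal 0 v) ≤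
      ENNReal.ofReal (Real.sqrt 2) := by
  have hv0 : (0 : ℝ) < v := by exact_mod_cast pos_iff_ne_zero.mpr hv
  rw [gaussianReal_of_var_ne_zero _ hv,
    lintegral_withDensity_eq_lintegral_mul _ (measurable_gaussianPDF 0 v) (by fun_prop)]
  -- Since `s ≤ 1/(4v)`, the tilt at most doubles the variance, and the ratio of normalizing
  -- constants is `√2`.
  have key : ∀ x : ℝ, gaussianPDF 0 v x * ENNReal.ofReal (Real.exp (s * x ^ 2)) ≤
      ENNReal.ofReal (Real.sqrt 2) * gaussianPDF 0 (2 * v) x := by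
    intro x
    rw [gaussianPDF_def, gaussianPDF_def, ← ENNReal.ofReal_mul (gaussianPDFReal_nonneg _ _ _),
      ← ENNReal.ofReal_mul (Real.sqrt_nonneg _)]
    apply ENNReal.ofReal_le_ofReal
    simp only [gaussianPDFReal_def, sub_zero, NNReal.coe_mul, NNReal.coe_ofNat]
    have h1 : Real.sqrt (2 * Real.pi * (2 * v)) = Real.sqrt 2 * Real.sqrt (2 * Real.pi * v) := by
      rw [← Real.sqrt_mul (by norm_num)]; ring_nf
    rw [h1, mul_inv, ← mul_assoc, ← mul_assoc, mul_inv_cancel₀ (by positivity), one_mul, mul_assoc,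
      ← Real.exp_add]
    gcongr
    have : s * x ^ 2 ≤ x ^ 2 / (4 * v) := by
      rw [le_div_iff₀ (by positivity)]
      nlinarith [sq_nonneg x]
    have e : -x ^ 2 / (2 * (2 * (v : ℝ))) = -x ^ 2 / (2 * v) + x ^ 2 / (4 * v) := by
      field_simp; ring
    linarith
  calc _ ≤ ∫⁻ x, ENNReal.ofReal (Real.sqrt 2) * gaussianPDF 0 (2 * v) x := lintegral_mono key
    _ = _ := by
      rw [lintegral_const_mul _ (measurable_gaussianPDF _ _),
        lintegral_gaussianPDF_eq_one _ (by simpa using hv), mul_one]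

theorem gaussianReal_abs_le_le {v : NNReal} (hv : v ≠ 0) {r : ℝ} :
    gaussianReal 0 v {x | |x| ≤ r} ≤ ENNReal.ofReal ((Real.sqrt (2 * Real.pi * v))⁻¹ * (2 * r)) := by
  have hs : {x : ℝ | |x| ≤ r} = Set.Icc (-r) r := by ext x; simp [abs_le]
  rw [hs, gaussianReal_apply _ hv]
  calc _ ≤ ∫⁻ _ in Set.Icc (-r) r, ENNReal.ofReal (Real.sqrt (2 * Real.pi * v))⁻¹ := by
        apply lintegral_mono
        intro x
        rw [gaussianPDF_def]
        apply ENNReal.ofReal_le_ofReal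
        rw [gaussianPDFReal_def]
        apply mul_le_of_le_one_right (by positivity)
        apply Real.exp_le_one_iff.mpr
        rw [neg_div]
        simp only [Left.neg_nonpos_iff]
        positivity
    _ = _ := by
        rw [lintegral_const, Measure.restrict_apply_univ, Real.volume_Icc,
          ← ENNReal.ofReal_mul (by positivity)]
        congr 2; ring

theorem multivariateGaussian_zero_map_inner {d : ℕ} {S : Matrix (Fin d) (Fin d) ℝ}
    (hS : S.PosSemidef) (u : EuclideanSpace ℝ (Fin d)) :
    (multivariateGaussian 0 S).map (fun z => inner ℝ z u) =
      gaussianReal 0 (u.ofLp ⬝ᵥ S.mulVec u.ofLp).toNNReal := by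
  have h : (fun z : EuclideanSpace ℝ (Fin d) => inner ℝ z u) = innerSL ℝ u := by
    ext z; simp [real_inner_comm]
  have hm : ∫ z, innerSL ℝ u z ∂(multivariateGaussian 0 S) = 0 := by
    rw [(innerSL ℝ u).integral_comp_id_comm IsGaussian.integrable_id,
      integral_id_multivariateGaussian, map_zero]
  rw [h, IsGaussian.map_eq_gaussianReal, hm,
    ← covarianceBilin_multivariateGaussian (μ := 0) hS,
    covarianceBilin_self IsGaussian.memLp_two_id]
  rfl

/-- The integral is linear in the measure and each component projects to a Gaussian whose variance
lies in `[λ‖u‖², Λ‖u‖²]`, so one-dimensional bounds uniform in that range suffice. -/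
theorem lintegral_centeredGaussianMixture_inner_le {d k : ℕ} {w : Fin k → ℝ} (hw : ∀ j, 0 ≤ w j)
    (hw1 : ∑ j, w j = 1) {S : Fin k → Matrix (Fin d) (Fin d) ℝ} {lam Lam : ℝ} (hlam : 0 < lam)
    (hS : ∀ j, (S j).PosDef)
    (hl : ∀ j, (S j - lam • (1 : Matrix (Fin d) (Fin d) ℝ)).PosSemidef)
    (hL : ∀ j, (Lam • (1 : Matrix (Fin d) (Fin d) ℝ) - S j).PosSemidef)
    {u : EuclideanSpace ℝ (Fin d)} (hu : u ≠ 0) {h : ℝ → ENNReal} (hh : Measurable h)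
    {B : ENNReal} (hB : ∀ v : NNReal, v ≠ 0 → lam * ‖u‖ ^ 2 ≤ v → v ≤ Lam * ‖u‖ ^ 2 →
      ∫⁻ x, h x ∂(gaussianReal 0 v) ≤ B) :
    ∫⁻ z, h (inner ℝ z u) ∂(centeredGaussianMixture w S) ≤ B := by
  have hu2 : u.ofLp ⬝ᵥ u.ofLp = ‖u‖ ^ 2 := by
    rw [EuclideanSpace.real_norm_sq_eq, dotProduct]
    exact Finset.sum_congr rfl fun i _ => (sq _).symm
  have hu0 : 0 < ‖u‖ := norm_pos_iff.mpr hu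
  rw [centeredGaussianMixture, lintegral_finsetSum_measure]
  calc _ ≤ ∑ j, ENNReal.ofReal (w j) * B := by
        apply Finset.sum_le_sum
        intro j _
        rw [lintegral_smul_measure, smul_eq_mul]
        gcongr
        have e : ∫⁻ z, h (inner ℝ z u) ∂(multivariateGaussian 0 (S j)) =
            ∫⁻ x, h x ∂((multivariateGaussian 0 (S j)).map (fun z => inner ℝ z u)) := by
          rw [lintegral_map hh (by fun_prop)]
        rw [e, multivariateGaussian_zero_map_inner (hS j).posSemidef]
        have h1 := (hl j).dotProduct_mulVec_nonneg u.ofLp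
        have h2 := (hL j).dotProduct_mulVec_nonneg u.ofLp
        simp only [Matrix.sub_mulVec, Matrix.smul_mulVec, Matrix.one_mulVec, dotProduct_sub,
          dotProduct_smul, star_trivial, hu2, smul_eq_mul] at h1 h2
        have h3 : 0 < lam * ‖u‖ ^ 2 := by positivity
        have h4 : 0 < u.ofLp ⬝ᵥ (S j).mulVec u.ofLp := by linarith
        apply hB
        · simpa using h4
        · rw [Real.coe_toNNReal _ h4.le]; linarith
        · rw [Real.coe_toNNReal _ h4.le]; linarith
    _ = B := by
        rw [← Finset.sum_mul, ← ENNReal.ofReal_sum_of_nonneg (fun j _ => hw j), hw1]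
        simp

/-! ### Chernoff's bound -/

/-- Chernoff's bound for a sum of independent identically distributed variables. -/
theorem measure_le_sum_le_of_lintegral_exp_le {Ω E : Type*} [MeasurableSpace Ω]
    [MeasurableSpace E] {P : Measure Ω} {ν : Measure E} {n : ℕ} {Z : Fin n → Ω → E}
    (hZ : ∀ i, HasLaw (Z i) ν P) (hI : iIndepFun Z P) {f : E → ℝ} (hf : Measurable f) {b : ℝ}
    (hb : ∫⁻ z, ENNReal.ofReal (Real.exp (f z)) ∂ν ≤ ENNReal.ofReal (Real.exp b)) (T : ℝ) :
    P {ω | T ≤ ∑ i, f (Z i ω)} ≤ ENNReal.ofReal (Real.exp (n * b - T)) := by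
  have hm : Measurable fun z => ENNReal.ofReal (Real.exp (f z)) := by fun_prop
  -- `HasLaw` gives only a.e. measurability; measurable versions are used to factor the integral.
  set Y : Fin n → Ω → E := fun i => (hZ i).aemeasurable.mk (Z i) with hY
  have hae : ∀ i, Z i =ᵐ[P] Y i := fun i => (hZ i).aemeasurable.ae_eq_mk
  have hYm : ∀ i, Measurable (Y i) := fun i => (hZ i).aemeasurable.measurable_mk
  have hYI : iIndepFun Y P := hI.congr hae
  have h1 : P {ω | T ≤ ∑ i, f (Z i ω)} = P {ω | T ≤ ∑ i, f (Y i ω)} := by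
    apply measure_congr
    filter_upwards [ae_all_iff.mpr hae] with ω hω
    apply propext
    change T ≤ ∑ i, f (Z i ω) ↔ T ≤ ∑ i, f (Y i ω)
    simp only [hω]
  have h2 : ∫⁻ ω, ENNReal.ofReal (Real.exp (∑ i, f (Y i ω))) ∂P ≤
      ENNReal.ofReal (Real.exp (n * b)) := by
    have e : ∀ ω, ENNReal.ofReal (Real.exp (∑ i, f (Y i ω))) =
        ∏ i, ENNReal.ofReal (Real.exp (f (Y i ω))) := by
      intro ω
      rw [Real.exp_sum, ENNReal.ofReal_prod_of_nonneg fun i _ => (Real.exp_pos _).le]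
    simp_rw [e]
    rw [lintegral_prod_eq_prod_lintegral_of_indepFun Finset.univ
      (fun i ω => ENNReal.ofReal (Real.exp (f (Y i ω)))) (hYI.comp _ fun _ => hm)
      fun i => hm.comp (hYm i)]
    calc _ ≤ ∏ _i : Fin n, ENNReal.ofReal (Real.exp b) := by
          apply Finset.prod_le_prod'
          intro i _
          rw [← lintegral_map (f := fun z => ENNReal.ofReal (Real.exp (f z))) hm (hYm i),
            ← Measure.map_congr (hae i), (hZ i).map_eq]
          exact hb
      _ = _ := by
          rw [Finset.prod_const, Finset.card_univ, Fintype.card_fin,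
            ← ENNReal.ofReal_pow (Real.exp_pos _).le, ← Real.exp_nat_mul]
  rw [h1]
  have h3 : {ω | T ≤ ∑ i, f (Y i ω)} =
      {ω | ENNReal.ofReal (Real.exp T) ≤ ENNReal.ofReal (Real.exp (∑ i, f (Y i ω)))} := by
    ext ω
    simp [ENNReal.ofReal_le_ofReal_iff (Real.exp_pos _).le]
  rw [h3]
  have hfY : Measurable fun ω => ∑ i, f (Y i ω) :=
    Finset.measurable_sum _ fun i _ => hf.comp (hYm i)
  refine (meas_ge_le_lintegral_div (by fun_prop) (by simp [Real.exp_pos])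
    ENNReal.ofReal_ne_top).trans ?_
  refine (ENNReal.div_le_div_right h2 _).trans ?_
  rw [← ENNReal.ofReal_div_of_pos (Real.exp_pos _), Real.exp_sub]

/-! ### Discretization by lattice points -/

/-- The point of `ℝᵈ` with the given integer coordinates. -/
noncomputable def latticePoint {d : ℕ} (q : Fin d → ℤ) : EuclideanSpace ℝ (Fin d) :=
  WithLp.toLp 2 fun j => (q j : ℝ)

/-- Coordinatewise rounding errs by at most `√d/2`; the cruder `d/2` avoids square roots and is
harmless since `m` is taken large. -/
theorem exists_latticePoint_norm_sub_le {d m : ℕ} (v : EuclideanSpace ℝ (Fin d)) (hv : ‖v‖ = m) :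
    ∃ q ∈ Fintype.piFinset fun _ : Fin d => Finset.Icc (-(m : ℤ)) m,
      ‖v - latticePoint q‖ ≤ (d : ℝ) / 2 := by
  refine ⟨fun j => round (v j), ?_, ?_⟩
  · rw [Fintype.mem_piFinset]
    intro j
    have h1 : |v j| ≤ m := by
      have := PiLp.norm_apply_le v j
      rwa [hv, Real.norm_eq_abs] at this
    obtain ⟨h1, h2⟩ := abs_le.mp h1
    rw [Finset.mem_Icc]
    obtain ⟨h3, h4⟩ := abs_le.mp (abs_sub_round (v j))
    have h5 : (-(m : ℤ) : ℝ) - 1 < round (v j) := by push_cast; linarith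
    have h6 : (round (v j) : ℝ) < (m : ℤ) + 1 := by push_cast; linarith
    constructor
    · have : -(m : ℤ) - 1 < round (v j) := by exact_mod_cast h5
      omega
    · have : round (v j) < (m : ℤ) + 1 := by exact_mod_cast h6
      omega
  · have h1 : ‖v - latticePoint fun j => round (v j)‖ ^ 2 ≤ (d : ℝ) / 4 := by
      rw [EuclideanSpace.real_norm_sq_eq]
      calc _ ≤ ∑ _j : Fin d, (1 / 4 : ℝ) := by
            apply Finset.sum_le_sum
            intro j _
            have := abs_sub_round (v j)
            have e : (v - latticePoint fun j => round (v j)).ofLp j = v j - round (v j) := rfl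
            rw [e, ← sq_abs]
            nlinarith [abs_nonneg (v j - round (v j))]
        _ = _ := by simp; ring
    have h2 : (d : ℝ) ≤ d ^ 2 := by
      rcases Nat.eq_zero_or_pos d with h | h
      · simp [h]
      · have : (1 : ℝ) ≤ d := by exact_mod_cast h
        nlinarith
    apply le_of_sq_le_sq _ (by positivity)
    nlinarith

theorem norm_toLp_inner_sq {n d : ℕ} (Z : Fin n → EuclideanSpace ℝ (Fin d))
    (v : EuclideanSpace ℝ (Fin d)) :
    ‖WithLp.toLp 2 (fun l : Fin n => (inner ℝ (Z l) v : ℝ))‖ ^ 2 = ∑ i, (inner ℝ (Z i) v) ^ 2 := by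
  rw [EuclideanSpace.real_norm_sq_eq]

/-- Second moment and small ball bounds at the lattice points of a large box imply strong
anti-concentration. -/
theorem strongAntiConcentration_of_lattice {n d m : ℕ} (hn : 0 < n) (hdn : d ≤ n)
    (Z : Fin n → EuclideanSpace ℝ (Fin d)) {ε a x : ℝ} (hε0 : 0 < ε) (hε1 : ε ≤ 1) (ha : 0 < a)
    (hx : 1 ≤ x) (hεn : 1 ≤ ε * n) (hm : 25 * x ^ 4 * n ^ 3 ≤ m)
    (hA : ∀ q ∈ Fintype.piFinset fun _ : Fin d => Finset.Icc (-(m : ℤ)) m, latticePoint q ≠ 0 →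
      ∑ i, (inner ℝ (Z i) (latticePoint q)) ^ 2 ≤ 4 * a ^ 2 * x ^ 6 * n * ‖latticePoint q‖ ^ 2)
    (hB : ∀ q ∈ Fintype.piFinset fun _ : Fin d => Finset.Icc (-(m : ℤ)) m, latticePoint q ≠ 0 →
      (Set.ncard {i : Fin n | |inner ℝ (Z i) (latticePoint q)| ≤
        3 / 5 * ε * a / x * ‖latticePoint q‖} : ℝ) ≤ ε * n) :
    StrongAntiConcentration Z ε (ε / (4 * x ^ 4)) := by
  have hn1 : (1 : ℝ) ≤ n := by exact_mod_cast hn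
  have hx4 : 1 ≤ x ^ 4 := one_le_pow₀ hx
  have hnn : (n : ℝ) ≤ n ^ 3 := le_self_pow₀ hn1 (by norm_num)
  have hmn : (n : ℝ) ≤ m := by nlinarith [mul_le_mul hx4 hnn (by positivity) (by positivity)]
  have hm0 : (0 : ℝ) < m := by linarith
  have hm1 : 1 ≤ m := by exact_mod_cast hm0
  have hdn' : (d : ℝ) ≤ n := by exact_mod_cast hdn
  set K : ℝ := 2 * a * x ^ 3 * n with hK
  have hK0 : 0 < K := by positivity
  -- The unit vectors are lattice points, so `hA` there bounds the Frobenius norm of `Z`, and with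
  -- it all rounding errors.
  have hZsum : ∑ i, ‖Z i‖ ^ 2 ≤ K ^ 2 := by
    have e : ∑ i, ‖Z i‖ ^ 2 = ∑ j : Fin d, ∑ i, (Z i j) ^ 2 := by
      rw [Finset.sum_comm]
      exact Finset.sum_congr rfl fun i _ => EuclideanSpace.real_norm_sq_eq _
    rw [e]
    calc _ ≤ ∑ _j : Fin d, 4 * a ^ 2 * x ^ 6 * n := by
          apply Finset.sum_le_sum
          intro j _
          have he : latticePoint (Pi.single j 1) = EuclideanSpace.single j (1 : ℝ) := by
            ext l
            by_cases hl : l = j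
            · subst hl; simp [latticePoint]
            · simp [latticePoint, hl]
          have := hA (Pi.single j 1) (by
            rw [Fintype.mem_piFinset]
            intro l
            by_cases hl : l = j
            · subst hl; simp; omega
            · simp [hl]) (by rw [he]; simp)
          rw [he] at this
          simpa [EuclideanSpace.inner_single_right] using this
      _ = d * (4 * a ^ 2 * x ^ 6 * n) := by simp
      _ ≤ n * (4 * a ^ 2 * x ^ 6 * n) := by gcongr
      _ = K ^ 2 := by rw [hK]; ring
  have hZi : ∀ i, ‖Z i‖ ≤ K := fun i => by
    apply le_of_sq_le_sq _ hK0.le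
    exact (Finset.single_le_sum (f := fun i => ‖Z i‖ ^ 2) (fun i _ => by positivity)
      (Finset.mem_univ i)).trans hZsum
  have hZw : ∀ w : EuclideanSpace ℝ (Fin d),
      ‖WithLp.toLp 2 (fun l : Fin n => (inner ℝ (Z l) w : ℝ))‖ ≤ K * ‖w‖ := fun w => by
    apply le_of_sq_le_sq _ (by positivity)
    rw [norm_toLp_inner_sq, mul_pow]
    calc _ ≤ ∑ i, ‖Z i‖ ^ 2 * ‖w‖ ^ 2 := by
          apply Finset.sum_le_sum
          intro i _
          rw [← sq_abs, ← mul_pow]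
          gcongr
          exact abs_real_inner_le_norm _ _
      _ ≤ _ := by rw [← Finset.sum_mul]; gcongr
  have main : ∀ v : EuclideanSpace ℝ (Fin d), ‖v‖ = m →
      (Set.ncard {i : Fin n | |inner ℝ (Z i) v| < ε / (4 * x ^ 4) / Real.sqrt n *
        ‖WithLp.toLp 2 (fun l : Fin n => (inner ℝ (Z l) v : ℝ))‖} : ℝ) ≤ ε * n := by
    intro v hv
    obtain ⟨q, hq, hqv⟩ := exists_latticePoint_norm_sub_le v hv
    set u := latticePoint q with hu
    have huv : ‖v - u‖ ≤ n / 2 := by linarith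
    have hun : (m : ℝ) / 2 ≤ ‖u‖ := by
      have := norm_sub_norm_le v u
      linarith
    have hu0 : u ≠ 0 := norm_pos_iff.mp (by linarith)
    refine le_trans ?_ (hB q hq hu0)
    rw [Nat.cast_le]
    apply Set.ncard_le_ncard _ (Set.toFinite _)
    intro i hi
    simp only [Set.mem_ofPred_eq] at hi ⊢
    have hsn : 0 < Real.sqrt n := Real.sqrt_pos.mpr (by linarith)
    have hsn1 : 1 ≤ Real.sqrt n := Real.one_le_sqrt.mpr hn1
    have hZu : ‖WithLp.toLp 2 (fun l : Fin n => (inner ℝ (Z l) u : ℝ))‖ ≤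
        2 * a * x ^ 3 * Real.sqrt n * ‖u‖ := by
      apply le_of_sq_le_sq _ (by positivity)
      rw [norm_toLp_inner_sq]
      refine (hA q hq hu0).trans_eq ?_
      rw [mul_pow, mul_pow, Real.sq_sqrt (by positivity)]
      ring
    have hZv : ‖WithLp.toLp 2 (fun l : Fin n => (inner ℝ (Z l) v : ℝ))‖ ≤
        2 * a * x ^ 3 * Real.sqrt n * ‖u‖ + K * (n / 2) := by
      have e : WithLp.toLp 2 (fun l : Fin n => (inner ℝ (Z l) v : ℝ)) =
          WithLp.toLp 2 (fun l : Fin n => (inner ℝ (Z l) u : ℝ)) +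
          WithLp.toLp 2 (fun l : Fin n => (inner ℝ (Z l) (v - u) : ℝ)) := by
        ext l; simp [inner_sub_right]
      rw [e]
      refine (norm_add_le _ _).trans (add_le_add hZu ((hZw _).trans ?_))
      gcongr
    have hiu : |inner ℝ (Z i) u| ≤ |inner ℝ (Z i) v| + K * (n / 2) := by
      have e : (inner ℝ (Z i) u : ℝ) = inner ℝ (Z i) v - inner ℝ (Z i) (v - u) := by
        rw [inner_sub_right]; ring
      rw [e]
      refine (abs_sub _ _).trans ?_
      gcongr
      refine (abs_real_inner_le_norm _ _).trans ?_
      gcongr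
      exact hZi i
    have h1 : ε / (4 * x ^ 4) / Real.sqrt n * (2 * a * x ^ 3 * Real.sqrt n * ‖u‖ + K * (n / 2)) ≤
        ε * a / (2 * x) * ‖u‖ + 1 / 4 * (K * (n / 2)) := by
      rw [mul_add]
      have hx0 : (0 : ℝ) < x := by linarith
      apply add_le_add
      · apply le_of_eq
        field_simp
        ring
      · refine mul_le_mul_of_nonneg_right ?_ (by positivity)
        rw [div_div, div_le_iff₀ (by positivity)]
        nlinarith [mul_le_mul hx4 hsn1 (by norm_num) (by positivity)]
    -- The rounding errors of the inner product and of the norm total 5/4 of `K n / 2`. With `‖u‖ ≥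
    -- m/2` and `εn ≥ 1`, the constant 25 in `hm` is exactly what fits them into the slack `3/5 -
    -- 1/2 = 1/10`.
    have h2 : 5 / 4 * (K * (n / 2)) ≤ 1 / 10 * ε * a / x * ‖u‖ := by
      have hx0 : (0 : ℝ) < x := by linarith
      rw [div_mul_eq_mul_div (_ * a) x, le_div_iff₀ hx0, hK]
      have h3 : 25 * x ^ 4 * n ^ 2 ≤ ε * m := by
        calc 25 * x ^ 4 * n ^ 2 = 25 * x ^ 4 * n ^ 2 * 1 := by ring
          _ ≤ 25 * x ^ 4 * n ^ 2 * (ε * n) := by gcongr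
          _ = ε * (25 * x ^ 4 * n ^ 3) := by ring
          _ ≤ _ := by gcongr
      have h4 : 25 * x ^ 4 * n ^ 2 ≤ 2 * (ε * ‖u‖) := by nlinarith
      nlinarith [mul_le_mul_of_nonneg_left h4 ha.le]
    have h3 : ε / (4 * x ^ 4) / Real.sqrt n *
        ‖WithLp.toLp 2 (fun l : Fin n => (inner ℝ (Z l) v : ℝ))‖ ≤
        ε * a / (2 * x) * ‖u‖ + 1 / 4 * (K * (n / 2)) := le_trans (by gcongr) h1
    have e : 3 / 5 * ε * a / x * ‖u‖ = ε * a / (2 * x) * ‖u‖ + 1 / 10 * ε * a / x * ‖u‖ := by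
      field_simp; ring
    rw [e]
    linarith
  intro β
  by_cases hβ : β = 0
  · subst hβ
    have : {i : Fin n | |inner ℝ (Z i) (0 : EuclideanSpace ℝ (Fin d))| <
        ε / (4 * x ^ 4) / Real.sqrt n * ‖WithLp.toLp 2 (fun l : Fin n =>
          (inner ℝ (Z l) (0 : EuclideanSpace ℝ (Fin d)) : ℝ))‖} = ∅ := by
      ext i
      have : ‖WithLp.toLp 2 (fun _ : Fin n => (0 : ℝ))‖ = 0 := by
        rw [norm_eq_zero]; rfl
      simp [this]
    rw [this]
    simp
    positivity
  · have hβ0 : 0 < ‖β‖ := norm_pos_iff.mpr hβ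
    set t : ℝ := m / ‖β‖ with ht
    have ht0 : 0 < t := by positivity
    have := main (t • β) (by
      rw [norm_smul, Real.norm_of_nonneg ht0.le, ht, div_mul_cancel₀ _ hβ0.ne'])
    convert this using 5 with i
    have e : WithLp.toLp 2 (fun l : Fin n => (inner ℝ (Z l) (t • β) : ℝ)) =
        t • WithLp.toLp 2 (fun l : Fin n => (inner ℝ (Z l) β : ℝ)) := by
      ext l; simp [inner_smul_right]
    rw [e, norm_smul, inner_smul_right, abs_mul, Real.norm_eq_abs, abs_of_pos ht0,
      mul_left_comm, mul_lt_mul_iff_right₀ ht0]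

/-! ### Tail bounds in a fixed direction -/

/-- Upper tail of the empirical second moment of a Gaussian mixture in a fixed direction. -/
theorem measure_sum_inner_sq_gt_le {n d k : ℕ} {w : Fin k → ℝ} (hw : ∀ j, 0 ≤ w j)
    (hw1 : ∑ j, w j = 1) {S : Fin k → Matrix (Fin d) (Fin d) ℝ} {lam Lam : ℝ} (hlam : 0 < lam)
    (hLam : 0 < Lam) (hS : ∀ j, (S j).PosDef)
    (hl : ∀ j, (S j - lam • (1 : Matrix (Fin d) (Fin d) ℝ)).PosSemidef)
    (hL : ∀ j, (Lam • (1 : Matrix (Fin d) (Fin d) ℝ) - S j).PosSemidef)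
    {Ω : Type*} [MeasurableSpace Ω] {P : Measure Ω} {Z : Fin n → Ω → EuclideanSpace ℝ (Fin d)}
    (hZ : ∀ i, HasLaw (Z i) (centeredGaussianMixture w S) P) (hI : iIndepFun Z P)
    {u : EuclideanSpace ℝ (Fin d)} (hu : u ≠ 0) (y : ℝ) :
    P {ω | 4 * Lam * y * n * ‖u‖ ^ 2 < ∑ i, (inner ℝ (Z i ω) u) ^ 2} ≤
      ENNReal.ofReal (Real.exp (n * (Real.log 2 / 2) - n * y)) := by
  have hu0 : 0 < ‖u‖ := norm_pos_iff.mpr hu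
  set s : ℝ := (4 * Lam * ‖u‖ ^ 2)⁻¹ with hs
  have hs0 : 0 < s := by positivity
  have hb : ∫⁻ z, ENNReal.ofReal (Real.exp (s * (inner ℝ z u) ^ 2)) ∂(centeredGaussianMixture w S) ≤
      ENNReal.ofReal (Real.exp (Real.log 2 / 2)) := by
    rw [← Real.log_sqrt (by norm_num), Real.exp_log (by positivity)]
    refine lintegral_centeredGaussianMixture_inner_le hw hw1 hlam hS hl hL hu
      (h := fun t => ENNReal.ofReal (Real.exp (s * t ^ 2))) (by fun_prop) ?_
    intro v hv _ hvL
    refine lintegral_exp_sq_gaussianReal_le hv ?_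
    rw [hs, inv_mul_le_iff₀ (by positivity)]
    linarith
  refine (measure_mono ?_).trans (measure_le_sum_le_of_lintegral_exp_le hZ hI
    (f := fun z => s * (inner ℝ z u) ^ 2) (by fun_prop) hb (n * y))
  intro ω hω
  simp only [Set.mem_ofPred_eq] at hω ⊢
  rw [← Finset.mul_sum, hs, le_inv_mul_iff₀ (by positivity)]
  linarith

/-- Upper tail of the number of samples of a Gaussian mixture in a thin slab around the origin. -/
theorem measure_ncard_abs_inner_le_gt_le {n d k : ℕ} {w : Fin k → ℝ} (hw : ∀ j, 0 ≤ w j)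
    (hw1 : ∑ j, w j = 1) {S : Fin k → Matrix (Fin d) (Fin d) ℝ} {a Lam : ℝ} (ha : 0 < a)
    (hS : ∀ j, (S j).PosDef)
    (hl : ∀ j, (S j - a ^ 2 • (1 : Matrix (Fin d) (Fin d) ℝ)).PosSemidef)
    (hL : ∀ j, (Lam • (1 : Matrix (Fin d) (Fin d) ℝ) - S j).PosSemidef)
    {Ω : Type*} [MeasurableSpace Ω] {P : Measure Ω} {Z : Fin n → Ω → EuclideanSpace ℝ (Fin d)}
    (hZ : ∀ i, HasLaw (Z i) (centeredGaussianMixture w S) P) (hI : iIndepFun Z P)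
    {u : EuclideanSpace ℝ (Fin d)} (hu : u ≠ 0) {ε x : ℝ} (hε : 0 < ε) (hx : 1 ≤ x) :
    P {ω | ε * n < (Set.ncard {i : Fin n | |inner ℝ (Z i ω) u| ≤ 3 / 5 * ε * a / x * ‖u‖} : ℝ)} ≤
      ENNReal.ofReal (Real.exp (n * ((2 * x - 1) * (ε / (2 * x))) - ε * n * Real.log (2 * x))) := by
  have hu0 : 0 < ‖u‖ := norm_pos_iff.mpr hu
  have hx0 : 0 < x := by linarith
  set r : ℝ := 3 / 5 * ε * a / x * ‖u‖ with hr
  have hr0 : 0 < r := by positivity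
  have hmr : MeasurableSet {t : ℝ | |t| ≤ r} := measurableSet_le (by fun_prop) (by fun_prop)
  -- Each hit has probability at most `ε/(2x)` while `εn` hits are needed, so the tilt is the log of
  -- the ratio, `log (2x)`.
  set g : ℝ → ℝ := {t : ℝ | |t| ≤ r}.indicator fun _ => Real.log (2 * x) with hg
  have hgm : Measurable g := measurable_const.indicator hmr
  have hgi : Measurable fun z : EuclideanSpace ℝ (Fin d) => g (inner ℝ z u) :=
    hgm.comp (by fun_prop)
  have hb : ∫⁻ z, ENNReal.ofReal (Real.exp (g (inner ℝ z u))) ∂(centeredGaussianMixture w S) ≤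
      ENNReal.ofReal (Real.exp ((2 * x - 1) * (ε / (2 * x)))) := by
    refine lintegral_centeredGaussianMixture_inner_le hw hw1 (by positivity) hS hl hL hu
      (h := fun t => ENNReal.ofReal (Real.exp (g t))) (by fun_prop) ?_
    intro v hv hva _
    have hp : (Real.sqrt (2 * Real.pi * v))⁻¹ * (2 * r) ≤ ε / (2 * x) := by
      -- Uses `2π > 6 > (12/5)²`; the slab width 3/5 is chosen to match.
      have h1 : 12 / 5 * a * ‖u‖ ≤ Real.sqrt (2 * Real.pi * v) := by
        apply Real.le_sqrt_of_sq_le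
        nlinarith [Real.pi_gt_three, mul_le_mul Real.pi_gt_three.le hva (by positivity)
          (by positivity)]
      rw [inv_mul_le_iff₀ (lt_of_lt_of_le (by positivity) h1)]
      refine le_trans (le_of_eq ?_) (mul_le_mul_of_nonneg_right h1 (by positivity))
      rw [hr]
      field_simp
      ring
    calc ∫⁻ t, ENNReal.ofReal (Real.exp (g t)) ∂(gaussianReal 0 v)
        ≤ ∫⁻ t, (1 + {t : ℝ | |t| ≤ r}.indicator (fun _ => ENNReal.ofReal (2 * x - 1)) t)
          ∂(gaussianReal 0 v) := by
          apply lintegral_mono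
          intro t
          by_cases ht : |t| ≤ r
          · have h1 : (1 : ENNReal) = ENNReal.ofReal 1 := by simp
            simp only [hg, Set.indicator, Set.mem_ofPred_eq, ht, if_true]
            rw [h1, ← ENNReal.ofReal_add (by norm_num) (by linarith), Real.exp_log (by linarith)]
            apply ENNReal.ofReal_le_ofReal
            linarith
          · simp [hg, Set.indicator, ht]
      _ = 1 + ENNReal.ofReal (2 * x - 1) * gaussianReal 0 v {t : ℝ | |t| ≤ r} := by
          rw [lintegral_add_left measurable_const, lintegral_indicator_const hmr]
          simp
      _ ≤ ENNReal.ofReal 1 + ENNReal.ofReal (2 * x - 1) * ENNReal.ofReal (ε / (2 * x)) := by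
          rw [ENNReal.ofReal_one]
          gcongr
          exact (gaussianReal_abs_le_le hv).trans (ENNReal.ofReal_le_ofReal hp)
      _ = ENNReal.ofReal ((2 * x - 1) * (ε / (2 * x)) + 1) := by
          rw [← ENNReal.ofReal_mul (by linarith), add_comm,
            ENNReal.ofReal_add (mul_nonneg (by linarith) (by positivity)) (by norm_num)]
      _ ≤ _ := ENNReal.ofReal_le_ofReal (Real.add_one_le_exp _)
  refine (measure_mono ?_).trans (measure_le_sum_le_of_lintegral_exp_le hZ hI
    (f := fun z => g (inner ℝ z u)) hgi hb (ε * n * Real.log (2 * x)))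
  intro ω hω
  simp only [Set.mem_ofPred_eq] at hω ⊢
  have e : ∑ i, g (inner ℝ (Z i ω) u) =
      (Set.ncard {i : Fin n | |inner ℝ (Z i ω) u| ≤ r} : ℝ) * Real.log (2 * x) := by
    classical
    simp only [hg, Set.indicator, Set.mem_ofPred_eq]
    rw [← Finset.sum_filter, Finset.sum_const, nsmul_eq_mul, Set.ncard_eq_toFinset_card']
    congr 3
    ext i
    simp
  rw [e]
  exact mul_le_mul_of_nonneg_right hω.le (Real.log_nonneg (by linarith))

/-! ### Comparing exponents with the size of the net -/

theorem exp_second_moment_le {n ε x : ℝ} (hn : 0 ≤ n) (hε1 : ε ≤ 1) (hx : 1 ≤ x) :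
    Real.exp (n * (Real.log 2 / 2) - n * x ^ 2) ≤
      Real.exp (-(ε * n * (19 / 100 + Real.log x / 2))) := by
  apply Real.exp_le_exp.mpr
  have h1 := Real.log_le_sub_one_of_pos (x := x ^ 2) (by positivity)
  rw [Real.log_pow] at h1
  push_cast at h1
  have h2 := Real.log_nonneg hx
  have h3 := Real.log_two_lt_d9
  have h4 : ε * n * (19 / 100 + Real.log x / 2) ≤ n * (19 / 100 + Real.log x / 2) := by
    have : ε * n ≤ n := mul_le_of_le_one_left hn hε1
    gcongr
  have h5 : n * (19 / 100 + Real.log x / 2) ≤ n * (x ^ 2 - Real.log 2 / 2) := by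
    gcongr
    linarith
  linarith

/-- Half of `log x` is spent on `log x ≥ 1 - 1/x`, leaving the constant `log 2 - 1/2 > 19/100`. -/
theorem exp_small_ball_le {n ε x : ℝ} (hn : 0 ≤ n) (hε0 : 0 ≤ ε) (hx : 1 ≤ x) :
    Real.exp (n * ((2 * x - 1) * (ε / (2 * x))) - ε * n * Real.log (2 * x)) ≤
      Real.exp (-(ε * n * (19 / 100 + Real.log x / 2))) := by
  apply Real.exp_le_exp.mpr
  have hx0 : 0 < x := by linarith
  have h1 := Real.one_sub_inv_le_log_of_pos hx0
  have h3 := Real.log_two_gt_d9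
  have e : n * ((2 * x - 1) * (ε / (2 * x))) = ε * n * (1 - x⁻¹ / 2) := by
    field_simp
  rw [e, Real.log_mul (by norm_num) hx0.ne']
  have h4 : ε * n * (19 / 100 + Real.log x / 2) ≤ ε * n * (Real.log 2 + Real.log x - (1 - x⁻¹ / 2)) := by
    gcongr
    linarith
  linarith

theorem card_mul_exp_le {n d m : ℕ} {ε x : ℝ} (hn : 2 ≤ n) (hd : 0 < d) (hε0 : 0 < ε) (hε1 : ε ≤ 1)
    (hx : 1 ≤ x) (hnd : 1000 * d * Real.log n ≤ ε ^ 2 * n) (hm : (m : ℝ) ≤ 25 * x ^ 4 * n ^ 3 + 1) :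
    ((2 * m + 1 : ℕ) : ℝ) ^ d * (2 * Real.exp (-(ε * n * (19 / 100 + Real.log x / 2)))) ≤
      Real.exp (-(1 / 10 * ε ^ 2 * n)) := by
  have hn2 : (2 : ℝ) ≤ n := by exact_mod_cast hn
  have hn0 : (0 : ℝ) < n := by linarith
  have hx0 : 0 < x := by linarith
  have hd1 : (1 : ℝ) ≤ d := by exact_mod_cast hd
  -- The numerical factor, at most 53, is absorbed by `n ^ 6 ≥ 64`.
  have h1 : ((2 * m + 1 : ℕ) : ℝ) ≤ Real.exp (9 * Real.log n + 4 * Real.log x) := by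
    rw [Real.exp_add, ← Real.log_rpow hn0, ← Real.log_rpow hx0, Real.exp_log (by positivity),
      Real.exp_log (by positivity)]
    norm_cast
    push_cast
    have h2 : (2 : ℝ) ^ 6 ≤ n ^ 6 := by gcongr
    have h3 : 1 ≤ x ^ 4 * n ^ 3 :=
      one_le_mul_of_one_le_of_one_le (one_le_pow₀ hx) (one_le_pow₀ (by linarith))
    nlinarith [mul_le_mul_of_nonneg_right h2 (by positivity : 0 ≤ x ^ 4 * (n : ℝ) ^ 3)]
  have h2 : (2 : ℝ) = Real.exp (Real.log 2) := (Real.exp_log (by norm_num)).symm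
  calc _ ≤ Real.exp (9 * Real.log n + 4 * Real.log x) ^ d *
        (Real.exp (Real.log 2) * Real.exp (-(ε * n * (19 / 100 + Real.log x / 2)))) := by
        rw [← h2]; gcongr
    _ = Real.exp (d * (9 * Real.log n + 4 * Real.log x) +
        (Real.log 2 + -(ε * n * (19 / 100 + Real.log x / 2)))) := by
        rw [← Real.exp_nat_mul, ← Real.exp_add, ← Real.exp_add]
    _ ≤ _ := by
        apply Real.exp_le_exp.mpr
        have hlog : Real.log 2 ≤ Real.log n := Real.log_le_log (by norm_num) hn2
        have h3 := Real.log_two_gt_d9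
        have h4 := Real.log_nonneg hx
        have h5 : ε ^ 2 * n ≤ ε * n := by
          have : ε ^ 2 ≤ ε := by nlinarith
          gcongr
        have h6 : Real.log n ≤ d * Real.log n := le_mul_of_one_le_left (by linarith) hd1
        -- This makes `4 d log x` smaller than the gain `εn log x / 2`.
        have h7 : 100 * (d : ℝ) ≤ ε * n := by nlinarith
        have h8 := mul_le_mul_of_nonneg_right h7 h4
        have h9 : 0 ≤ d * Real.log x := by positivity
        nlinarith

/-! ### Degenerate cases and the main theorem -/

theorem strongAntiConcentration_of_one_le {n d : ℕ} (Z : Fin n → EuclideanSpace ℝ (Fin d))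
    {ε : ℝ} (hε : 1 ≤ ε) (δ : ℝ) : StrongAntiConcentration Z ε δ := by
  intro β
  have h1 : Set.ncard {i : Fin n | |inner ℝ (Z i) β| <
      δ / Real.sqrt n * ‖WithLp.toLp 2 (fun l : Fin n => (inner ℝ (Z l) β : ℝ))‖} ≤ n :=
    (Set.ncard_le_card _).trans_eq (by simp)
  calc _ ≤ (n : ℝ) := by exact_mod_cast h1
    _ ≤ ε * n := le_mul_of_one_le_left (by positivity) hε

/-- For `n = 1` the sample size condition is void, as `log 1 = 0`; but `|t| < δ|t|` is impossible
for `δ ≤ 1`. -/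
theorem strongAntiConcentration_one {d : ℕ} (Z : Fin 1 → EuclideanSpace ℝ (Fin d))
    {ε δ : ℝ} (hε : 0 ≤ ε) (hδ : δ ≤ 1) : StrongAntiConcentration Z ε δ := by
  intro β
  have e : {i : Fin 1 | |inner ℝ (Z i) β| <
      δ / Real.sqrt (1 : ℕ) * ‖WithLp.toLp 2 (fun l : Fin 1 => (inner ℝ (Z l) β : ℝ))‖} = ∅ := by
    rw [Set.eq_empty_iff_forall_notMem]
    intro i hi
    have hi0 : i = 0 := Subsingleton.elim _ _
    subst hi0
    simp only [Set.mem_ofPred_eq] at hi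
    rw [EuclideanSpace.norm_eq] at hi
    simp only [Nat.cast_one, Real.sqrt_one, div_one, Finset.univ_unique, Fin.default_eq_zero,
      Finset.sum_singleton, Real.norm_eq_abs, sq_abs, Real.sqrt_sq_eq_abs] at hi
    nlinarith [abs_nonneg (inner ℝ (Z 0) β)]
  rw [e]
  simpa using hε

/-- Subadditivity alone is used, so the event, an intersection over uncountably many `β`, need not
be shown measurable. -/
theorem one_sub_le_measureReal_of_compl_le {Ω : Type*} [MeasurableSpace Ω] {P : Measure Ω}
    [IsProbabilityMeasure P] {s t : Set Ω} {δ : ℝ} (hδ : 0 ≤ δ) (hs : ∀ ω, ω ∉ t → ω ∈ s)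
    (ht : P t ≤ ENNReal.ofReal δ) : 1 - δ ≤ P.real s := by
  have h1 : (1 : ℝ) ≤ P.real s + P.real t := by
    rw [← probReal_univ (μ := P)]
    refine (measureReal_mono ?_).trans (measureReal_union_le s t)
    intro ω _
    by_cases h : ω ∈ t
    · exact Or.inr h
    · exact Or.inl (hs ω h)
  have h2 : P.real t ≤ δ := ENNReal.toReal_le_of_le_ofReal hδ ht
  linarith

theorem mainTheorem7 :
    ∃ C : ℝ, 0 < C ∧ ∃ c : ℝ, 0 < c ∧
      ∀ (n d k : ℕ) (ε : ℝ), 0 < n → 0 < d → 0 < k → 0 < ε →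
      ∀ (S : Fin k → Matrix (Fin d) (Fin d) ℝ) (lam Lam : ℝ), 0 < lam → 0 < Lam →
      (∀ j, (S j).PosDef) →
      (∀ j, (S j - lam • (1 : Matrix (Fin d) (Fin d) ℝ)).PosSemidef) →
      (∀ j, (Lam • (1 : Matrix (Fin d) (Fin d) ℝ) - S j).PosSemidef) →
      ∀ w : Fin k → ℝ, (∀ j, 0 ≤ w j) → ∑ j, w j = 1 →
      ∀ (Ω : Type*) [MeasurableSpace Ω] (P : Measure Ω) [IsProbabilityMeasure P]
        (Z : Fin n → Ω → EuclideanSpace ℝ (Fin d)),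
      (∀ i, HasLaw (Z i) (centeredGaussianMixture w S) P) → iIndepFun Z P →
      C * d * Real.log n / ε ^ 2 ≤ n →
      1 - Real.exp (-(c * ε ^ 2 * n)) ≤
        P.real {ω | StrongAntiConcentration (fun i => Z i ω) ε (ε / (4 * (Lam / lam)))} := by
  refine ⟨1000, by norm_num, 1 / 10, by norm_num, ?_⟩
  intro n d k ε hn hd hk hε S lam Lam hlam hLam hS hl hL w hw hw1 Ω _ P _ Z hZ hI hnd
  have hκ : 1 ≤ Lam / lam := by
    rw [one_le_div hlam]
    have h1 := (hl ⟨0, hk⟩).diag_nonneg (i := ⟨0, hd⟩)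
    have h2 := (hL ⟨0, hk⟩).diag_nonneg (i := ⟨0, hd⟩)
    simp only [Matrix.sub_apply, Matrix.smul_apply, Matrix.one_apply_eq, smul_eq_mul] at h1 h2
    linarith
  rcases le_or_gt 1 ε with hε1 | hε1
  · refine one_sub_le_measureReal_of_compl_le (t := ∅) (Real.exp_pos _).le (fun ω _ => ?_) (by simp)
    exact strongAntiConcentration_of_one_le _ hε1 _
  obtain rfl | hn2 : n = 1 ∨ 2 ≤ n := by omega
  · refine one_sub_le_measureReal_of_compl_le (t := ∅) (Real.exp_pos _).le (fun ω _ => ?_) (by simp)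
    refine strongAntiConcentration_one _ hε.le ?_
    rw [div_le_one (by positivity)]
    linarith
  -- The fourth root of `κ` keeps every bound polynomial in `x`.
  set x : ℝ := Real.sqrt (Real.sqrt (Lam / lam)) with hxdef
  have hx : 1 ≤ x := Real.one_le_sqrt.mpr (Real.one_le_sqrt.mpr hκ)
  have hx4 : x ^ 4 = Lam / lam := by
    rw [show x ^ 4 = (x ^ 2) ^ 2 by ring, hxdef, Real.sq_sqrt (by positivity),
      Real.sq_sqrt (by positivity)]
  set a : ℝ := Real.sqrt lam with hadef
  have ha : 0 < a := Real.sqrt_pos.mpr hlam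
  have ha2 : a ^ 2 = lam := Real.sq_sqrt hlam.le
  have hLx : Lam = a ^ 2 * x ^ 4 := by
    rw [ha2, hx4]; field_simp
  have hn2' : (2 : ℝ) ≤ n := by exact_mod_cast hn2
  have hd1 : (1 : ℝ) ≤ d := by exact_mod_cast hd
  have hnd' : 1000 * d * Real.log n ≤ ε ^ 2 * n := by
    rw [div_le_iff₀ (by positivity)] at hnd
    linarith
  have hlogn : 1 / 2 ≤ Real.log n := by
    have := Real.log_le_log (by norm_num) hn2'
    linarith [Real.log_two_gt_d9]
  have hdε : (d : ℝ) ≤ ε ^ 2 * n := by nlinarith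
  have hεε : ε ^ 2 ≤ ε := by nlinarith
  have hdεn : (d : ℝ) ≤ ε * n := hdε.trans (by gcongr)
  have hdn : d ≤ n := by
    have : (d : ℝ) ≤ n := by nlinarith
    exact_mod_cast this
  set m : ℕ := ⌈25 * x ^ 4 * n ^ 3⌉₊ with hmdef
  have hm1 : 25 * x ^ 4 * n ^ 3 ≤ m := Nat.le_ceil _
  have hm2 : (m : ℝ) ≤ 25 * x ^ 4 * n ^ 3 + 1 := (Nat.ceil_lt_add_one (by positivity)).le
  set G := Fintype.piFinset fun _ : Fin d => Finset.Icc (-(m : ℤ)) m with hG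
  set A : (Fin d → ℤ) → Set Ω := fun q => {ω | 4 * Lam * x ^ 2 * n * ‖latticePoint q‖ ^ 2 <
    ∑ i, (inner ℝ (Z i ω) (latticePoint q)) ^ 2} with hA
  set B : (Fin d → ℤ) → Set Ω := fun q => {ω | ε * n < (Set.ncard {i : Fin n |
    |inner ℝ (Z i ω) (latticePoint q)| ≤ 3 / 5 * ε * a / x * ‖latticePoint q‖} : ℝ)} with hB
  set D : ℝ := Real.exp (-(ε * n * (19 / 100 + Real.log x / 2))) with hD
  have hAD : ∀ q : Fin d → ℤ, latticePoint q ≠ 0 → P (A q) ≤ ENNReal.ofReal D := fun q hq =>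
    (measure_sum_inner_sq_gt_le hw hw1 hlam hLam hS hl hL hZ hI hq (x ^ 2)).trans
      (ENNReal.ofReal_le_ofReal (exp_second_moment_le (by positivity) hε1.le hx))
  have hBD : ∀ q : Fin d → ℤ, latticePoint q ≠ 0 → P (B q) ≤ ENNReal.ofReal D := fun q hq =>
    (measure_ncard_abs_inner_le_gt_le hw hw1 ha hS (by rwa [ha2]) hL hZ hI hq hε hx).trans
      (ENNReal.ofReal_le_ofReal (exp_small_ball_le (by positivity) hε.le hx))
  classical
  refine one_sub_le_measureReal_of_compl_le
    (t := ⋃ q ∈ G.filter fun q => latticePoint q ≠ 0, A q ∪ B q) (Real.exp_pos _).le ?_ ?_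
  · intro ω hω
    simp only [Set.mem_iUnion, not_exists, Finset.mem_filter, Set.mem_union, not_or, and_imp] at hω
    rw [Set.mem_ofPred_eq, ← hx4]
    refine strongAntiConcentration_of_lattice hn hdn _ hε hε1.le ha hx (hd1.trans hdεn) hm1 ?_ ?_
    · intro q hq hq0
      refine (not_lt.mp (hω q hq hq0).1).trans_eq ?_
      rw [hLx]; ring
    · intro q hq hq0
      exact not_lt.mp (hω q hq hq0).2
  · calc _ ≤ ∑ q ∈ G.filter fun q => latticePoint q ≠ 0, P (A q ∪ B q) :=
          measure_biUnion_finset_le _ _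
      _ ≤ ∑ _q ∈ G.filter fun q => latticePoint q ≠ 0, ENNReal.ofReal (2 * D) := by
          apply Finset.sum_le_sum
          intro q hq
          have hq0 := (Finset.mem_filter.mp hq).2
          rw [two_mul, ENNReal.ofReal_add (Real.exp_pos _).le (Real.exp_pos _).le]
          exact (measure_union_le _ _).trans (add_le_add (hAD q hq0) (hBD q hq0))
      _ ≤ ∑ _q ∈ G, ENNReal.ofReal (2 * D) :=
          Finset.sum_le_sum_of_subset (Finset.filter_subset _ _)
      _ = ENNReal.ofReal (((2 * m + 1 : ℕ) : ℝ) ^ d * (2 * D)) := by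
          have hcard : G.card = (2 * m + 1) ^ d := by
            rw [hG, Fintype.card_piFinset]
            simp only [Int.card_Icc, Finset.prod_const, Finset.card_univ, Fintype.card_fin]
            congr 1
            omega
          rw [Finset.sum_const, hcard, nsmul_eq_mul, ← Nat.cast_pow,
            ENNReal.ofReal_mul (Nat.cast_nonneg _), ENNReal.ofReal_natCast]
      _ ≤ _ := ENNReal.ofReal_le_ofReal (card_mul_exp_le hn2 hd hε hε1.le hx hnd' hm2)
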